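/- Let $G$ be a locally compact, second countable topological group with identity $I_d$ (for instance a matrix Lie group), whose topology is given by a right-invariant distance $d$; let $\mathcal B_o(g,r)$ denote open balls and $\mu_G$ a right-invariant Haar measure. Let $\mathcal Y$ be a measurable space with a measurable left action of $G$, let $h:G\times\mathbb R^p\to\mathcal Y$ and $K:\mathcal Y\to G$ be measurable with $K(h(I_d,0))=I_d$, and let $\Upsilon\in G$. Suppose that the map $g\mapsto K(h(g,0))$ is continuous on $G$. Let $W_n$ (with values in $G$) and $V_n$ (with values in $\mathbb R^p$) be noises with laws $\mathcal L_W$, $\mathcal L_V$ that do not depend on $n$, and suppose that $h$ is left-right equivariant: for all $g,\chi\in G$, $h(\chi g,V_n)$ and $g^{-1}h(\chi,V_n)$ have the same law, and $h(\chi g,0)=g^{-1}h(\chi,0)$. For right-hand inputs $\Omega_n\in G$ consider the system and the filter with constant gain function $$\chi_{n+1}=\Upsilon W_n\chi_n\Omega_n,\quad Y_n=h(\chi_n,V_n),\qquad \hat\chi'_{n+1}=\Upsilon\hat\chi_n\Omega_n,\quad \hat\chi_{n+1}=K(\hat\chi'_{n+1}Y_{n+1})\,\hat\chi'_{n+1},$$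 where the variables $W_n,V_{n+1}$ $(n\ge 0)$ are mutually independent and independent of $(\chi_0,\hat\chi_0)$. Let $\eta_n=\chi_n\hat\chi_n^{-1}$ be the error. Its law evolves as that of the homogeneous Markov chain $$\eta'_{n+1}=\Upsilon W_n\eta_n\Upsilon^{-1},\qquad \eta_{n+1}=\eta'_{n+1}K(h(\eta'_{n+1},V_{n+1}))^{-1}.$$ Let $C\subset G$ be a nonempty compact set with $C=\mathrm{cl}(C^\circ)$, let $\alpha>0$, and assume: 1. (Confinement) if the Markov chain starts at a point of $C$, then $\eta_n\in C$ almost surely for all $n$; 2. (Diffusivity) there is $\epsilon>0$ such that the density with respect to $\mu_G$ of the absolutely continuous part of $\mathcal L_W$ is at least $\epsilon$ at $\mu_G$-almost every point of $\mathcal B_o(I_d,\alpha)$; 3. (Reasonable output noise) there is $\epsilon'>0$ such that $\mathbb P\big[gK(h(g,V_n))^{-1}\in\mathcal B_o\big(gK(h(g,0))^{-1},\tfrac\alpha2\big)\big]>\epsilon'$ for all $g\in G$. Suppose finally that for every $\gamma_0\in C$, except on a set of null Haar measure, the noiseless error, defined by $\gamma'_{n+1}=\Upsilon\gamma_n\Upsilon^{-1}$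 and $\gamma_{n+1}=\gamma'_{n+1}K(h(\gamma'_{n+1},0))^{-1}$, converges to $I_d$. Then the Markov chain has a stationary distribution $\pi$ supported by $C$, it has no other stationary distribution supported by $C$, and for every prior law $\mu_0$ of $\eta_0$ supported by $C$ the law $\mu_n$ of $\eta_n$ converges to $\pi$ in total variation: $\lim_n\|\mu_n-\pi\|_{T.V.}=0$. The same $\pi$ serves for the Markov chain and for the errors of the filter, whatever the right-hand inputs, the probability space and the initial state and estimate with $\eta_0\in C$ almost surely. -/

import Mathlib

open MeasureTheory ProbabilityTheory Filter Topology
open scoped ENNReal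

namespace InvariantFilter

noncomputable section

/-- A right-invariant Haar measure on `G` (image under inversion of the left one). -/
def rightHaar (G : Type*) [Group G] [TopologicalSpace G] [IsTopologicalGroup G]
    [LocallyCompactSpace G] [MeasurableSpace G] [BorelSpace G] : Measure G :=
  (Measure.haar : Measure G).inv

/-- Total variation norm of `μ - ν`, valued in `[0, ∞]`. -/
def tvDist {X : Type*} [MeasurableSpace X] (μ ν : Measure X)
    [IsFiniteMeasure μ] [IsFiniteMeasure ν] : ℝ≥0∞ :=
  (μ.toSignedMeasure - ν.toSignedMeasure).totalVariation Set.univ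

/-- The noise space `ℝ^p`. -/
abbrev Noise (p : ℕ) : Type := EuclideanSpace ℝ (Fin p)

/-- The output map is left-right equivariant: in law for the noisy outputs, exactly for the
noiseless ones. -/
structure LeftRightEquivariant {G Y : Type*} {p : ℕ} [Group G] [MulAction G Y]
    [MeasurableSpace Y] (h : G → Noise p → Y) (lawV : Measure (Noise p)) : Prop where
  in_law : ∀ g χ : G, lawV.map (fun v => h (χ * g) v) = lawV.map (fun v => g⁻¹ • h χ v)
  noiseless : ∀ g χ : G, h (χ * g) 0 = g⁻¹ • h χ 0

/-- The correction `η' ↦ η' K(h(η', v))⁻¹` of the error. -/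
def correct {G Y : Type*} {p : ℕ} [Group G] (K : Y → G) (h : G → Noise p → Y)
    (x : G) (v : Noise p) : G :=
  x * (K (h x v))⁻¹

/-- One step `η ↦ η' = Υ w η Υ⁻¹ ↦ η' K(h(η', v))⁻¹` of the noisy error. -/
def errorStep {G Y : Type*} {p : ℕ} [Group G] (Υ : G) (K : Y → G) (h : G → Noise p → Y)
    (x w : G) (v : Noise p) : G :=
  correct K h (Υ * w * x * Υ⁻¹) v

/-- One step `γ ↦ γ' = Υ γ Υ⁻¹ ↦ γ' K(h(γ', 0))⁻¹` of the error with noises turned off. -/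
def noiselessStep {G Y : Type*} {p : ℕ} [Group G] (Υ : G) (K : Y → G) (h : G → Noise p → Y)
    (x : G) : G :=
  correct K h (Υ * x * Υ⁻¹) 0

/-- The law of the next error, if the current error has law `μ` and is independent of the two
(independent) noises, which have laws `lawW` and `lawV`. -/
def nextLaw {G Y : Type*} {p : ℕ} [Group G] [MeasurableSpace G] (Υ : G) (K : Y → G)
    (h : G → Noise p → Y) (lawW : Measure G) (lawV : Measure (Noise p)) (μ : Measure G) :
    Measure G :=
  (μ.prod (lawW.prod lawV)).map fun z => errorStep Υ K h z.1 z.2.1 z.2.2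

/-- The law of the `n`-th error of the Markov chain started from the law `μ`. -/
def errorLaw {G Y : Type*} {p : ℕ} [Group G] [MeasurableSpace G] (Υ : G) (K : Y → G)
    (h : G → Noise p → Y) (lawW : Measure G) (lawV : Measure (Noise p)) (μ : Measure G) :
    ℕ → Measure G
  | 0 => μ
  | n + 1 => nextLaw Υ K h lawW lawV (errorLaw Υ K h lawW lawV μ n)

instance errorLaw_isFiniteMeasure {G Y : Type*} {p : ℕ} [Group G] [MeasurableSpace G] (Υ : G)
    (K : Y → G) (h : G → Noise p → Y) (lawW : Measure G) [IsFiniteMeasure lawW]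
    (lawV : Measure (Noise p)) [IsFiniteMeasure lawV] (μ : Measure G) [IsFiniteMeasure μ]
    (n : ℕ) : IsFiniteMeasure (errorLaw Υ K h lawW lawV μ n) := by
  induction n with
  | zero => simpa [errorLaw]
  | succ n ih => unfold errorLaw nextLaw; infer_instance

/-- A stationary distribution of the noisy error. -/
def IsStationary {G Y : Type*} {p : ℕ} [Group G] [MeasurableSpace G] (Υ : G) (K : Y → G)
    (h : G → Noise p → Y) (lawW : Measure G) (lawV : Measure (Noise p)) (π : Measure G) : Prop :=
  nextLaw Υ K h lawW lawV π = π

/-- Confinement: started at any point of `C`, the error stays in `C` almost surely. -/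
def Confined {G Y : Type*} {p : ℕ} [Group G] [MeasurableSpace G] (Υ : G) (K : Y → G)
    (h : G → Noise p → Y) (lawW : Measure G) (lawV : Measure (Noise p)) (C : Set G) : Prop :=
  ∀ x ∈ C, ∀ n : ℕ, ∀ᵐ y ∂(errorLaw Υ K h lawW lawV (Measure.dirac x) n), y ∈ C

/-- Diffusivity: the density with respect to Haar measure of the continuous part of the process
noise is bounded away from zero on the open ball of radius `α` around the identity. -/
def Diffusive {G : Type*} [Group G] [MetricSpace G] [IsTopologicalGroup G]
    [LocallyCompactSpace G] [MeasurableSpace G] [BorelSpace G] (lawW : Measure G) (α : ℝ) : Prop :=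
  ∃ ε : ℝ, 0 < ε ∧ ∀ᵐ g ∂((rightHaar G).restrict (Metric.ball 1 α)),
    ENNReal.ofReal ε ≤ lawW.rnDeriv (rightHaar G) g

/-- Reasonable output noise: the noisy correction is within `α / 2` of the noiseless one with
probability bounded away from zero. -/
def ReasonableOutput {G Y : Type*} {p : ℕ} [Group G] [MetricSpace G] (K : Y → G)
    (h : G → Noise p → Y) (lawV : Measure (Noise p)) (α : ℝ) : Prop :=
  ∃ ε : ℝ, 0 < ε ∧ ∀ g : G,
    ENNReal.ofReal ε < lawV {v | correct K h g v ∈ Metric.ball (correct K h g 0) (α / 2)}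

/-- The processes on a probability space `(Ω, P)` that make up the system
`χ (n+1) = Υ W_n χ_n Ω_n`, `Y_n = h(χ_n, V_n)` and the filter with constant gain function `K`.
`inp` is the sequence of right-hand inputs, `est` the corrected estimate and `pred` the
predicted one. The noise pairs `(W_n, V_(n+1))` are independent and identically distributed, with
independent components, and are independent of the initial state and estimate. -/
structure IsFilterRun {G Y Ω : Type*} {p : ℕ} [Group G] [MulAction G Y] [MeasurableSpace G]
    [MeasurableSpace Ω] (Υ : G) (K : Y → G) (h : G → Noise p → Y)
    (lawW : Measure G) (lawV : Measure (Noise p)) (inp : ℕ → G) (P : Measure Ω)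
    (W : ℕ → Ω → G) (V : ℕ → Ω → Noise p) (χ : ℕ → Ω → G) (out : ℕ → Ω → Y)
    (pred est : ℕ → Ω → G) : Prop where
  measurable_W : ∀ n, Measurable (W n)
  measurable_V : ∀ n, Measurable (V n)
  measurable_init : Measurable (χ 0) ∧ Measurable (est 0)
  noise_law : ∀ n, P.map (fun ω => (W n ω, V (n + 1) ω)) = lawW.prod lawV
  noise_indep : iIndepFun (fun n ω => (W n ω, V (n + 1) ω)) P
  init_indep : IndepFun (fun ω => (χ 0 ω, est 0 ω)) (fun ω n => (W n ω, V (n + 1) ω)) P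
  state : ∀ n ω, χ (n + 1) ω = Υ * W n ω * χ n ω * inp n
  output : ∀ n ω, out n ω = h (χ n ω) (V n ω)
  predict : ∀ n ω, pred (n + 1) ω = Υ * est n ω * inp n
  update : ∀ n ω, est (n + 1) ω = K (pred (n + 1) ω • out (n + 1) ω) * pred (n + 1) ω

/-- The error `η_n = χ_n est_n⁻¹`. -/
def filterError {G Ω : Type*} [Group G] (χ est : ℕ → Ω → G) (n : ℕ) (ω : Ω) : G :=
  χ n ω * (est n ω)⁻¹

end

end InvariantFilter

/-! The argument is Doeblin's. If some iterate of the chain, started anywhere in `C`, has law above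
one fixed nonzero measure `ν`, then two copies of the chain acquire a common part of mass `ν(univ)`
at each such block. Their unmatched masses decay geometrically, which gives existence and uniqueness
of the stationary law as well as convergence in total variation (`exists_stationary_tendsto`).

The measure `ν` is a multiple of Haar measure on a small ball around the identity, pushed through
one last correction (`exists_minorization`). From `x` in `C`, the process noise spreads the error
with a density bounded below on the ball of radius `α` about `x`. Since `C` is the closure of its
interior, this ball contains a point `γ` whose noiseless orbit converges to `1`. The noisy chain
follows that orbit with positive probability: the output noise loses at most `α / 2` with
probability bounded below, and the next process noise restores a Haar lower bound on a ball of fixed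
radius around the next orbit point. All orbits end near `1`, so compactness of `C` gives one number
of steps and one constant for all `x`.

Finally, equivariance makes the next error of the filter depend in law on state and estimate only
through the current error. Hence the filter errors have the laws of the chain, and the inputs
disappear (`IsFilterRun.map_filterError`). -/

namespace InvariantFilter

/-! ### Total variation and Doeblin's theorem for a minorized kernel. -/

section Doeblin

variable {X : Type*} [MeasurableSpace X]

/-- The common part cancels in the difference. On a Hahn set `i`, the positive part of `r - r'` has
mass at most `r i`, and the negative part has mass at most `r' iᶜ`. -/
lemma tvDist_le_of_eq_add {μ μ' σ r r' : Measure X} [IsFiniteMeasure μ] [IsFiniteMeasure μ']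
    (hμ : μ = σ + r) (hμ' : μ' = σ + r') : tvDist μ μ' ≤ r Set.univ + r' Set.univ := by
  have hσ : IsFiniteMeasure σ := isFiniteMeasure_of_le μ (hμ ▸ Measure.le_add_right le_rfl)
  have hr : IsFiniteMeasure r := isFiniteMeasure_of_le μ (hμ ▸ Measure.le_add_left le_rfl)
  have hr' : IsFiniteMeasure r' := isFiniteMeasure_of_le μ' (hμ' ▸ Measure.le_add_left le_rfl)
  have key : μ.toSignedMeasure - μ'.toSignedMeasure = r.toSignedMeasure - r'.toSignedMeasure := by
    ext s hs
    simp [hs, Measure.toSignedMeasure_apply, hμ, hμ']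
  unfold tvDist
  rw [key]
  obtain ⟨i, hi, h1, h2, hp, hn⟩ :=
    (r.toSignedMeasure - r'.toSignedMeasure).toJordanDecomposition_spec
  rw [SignedMeasure.totalVariation, Measure.add_apply, hp, hn,
    SignedMeasure.toMeasureOfZeroLE_apply _ _ _ MeasurableSet.univ,
    SignedMeasure.toMeasureOfLEZero_apply _ _ _ MeasurableSet.univ]
  refine add_le_add ?_ ?_
  · rw [← ENNReal.ofReal_toReal (measure_ne_top r Set.univ), ENNReal.ofReal,
      ENNReal.coe_le_coe, Real.le_toNNReal_iff_coe_le ENNReal.toReal_nonneg]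
    simp only [NNReal.coe_mk, sub_apply, Set.inter_univ,
      Measure.toSignedMeasure_apply_measurable hi]
    have := measureReal_nonneg (μ := r') (s := i)
    have h3 : r.real i ≤ r.real Set.univ := measureReal_mono (Set.subset_univ _)
    simp only [Measure.real] at *
    linarith
  · rw [← ENNReal.ofReal_toReal (measure_ne_top r' Set.univ), ENNReal.ofReal,
      ENNReal.coe_le_coe, Real.le_toNNReal_iff_coe_le ENNReal.toReal_nonneg]
    simp only [NNReal.coe_mk, sub_apply, Set.inter_univ,
      Measure.toSignedMeasure_apply_measurable hi.compl]
    have := measureReal_nonneg (μ := r) (s := iᶜ)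
    have h3 : r'.real iᶜ ≤ r'.real Set.univ := measureReal_mono (Set.subset_univ _)
    simp only [Measure.real] at *
    linarith

/-- The iterates of a kernel. -/
noncomputable def kernelPow (κ : Kernel X X) : ℕ → Kernel X X
  | 0 => Kernel.id
  | n + 1 => κ ∘ₖ kernelPow κ n

lemma kernelPow_comp (κ : Kernel X X) (n : ℕ) (μ : Measure X) :
    kernelPow κ n ∘ₘ μ = (fun m : Measure X => κ ∘ₘ m)^[n] μ := by
  induction n with
  | zero => simp [kernelPow]
  | succ n ih =>
    rw [Function.iterate_succ_apply', ← ih, kernelPow, Measure.comp_assoc]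

lemma kernelPow_apply (κ : Kernel X X) (n : ℕ) (x : X) :
    kernelPow κ n x = (fun m : Measure X => κ ∘ₘ m)^[n] (Measure.dirac x) := by
  rw [← kernelPow_comp, Measure.dirac_bind (Kernel.measurable _)]

instance isMarkovKernel_kernelPow (κ : Kernel X X) [IsMarkovKernel κ] (n : ℕ) :
    IsMarkovKernel (kernelPow κ n) := by
  induction n with
  | zero => unfold kernelPow; infer_instance
  | succ n ih => unfold kernelPow; infer_instance

lemma comp_mono {Z : Type*} [MeasurableSpace Z] (τ : Kernel X Z) {μ μ' : Measure X}
    (h : μ ≤ μ') : τ ∘ₘ μ ≤ τ ∘ₘ μ' := by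
  refine Measure.le_iff.2 fun s hs => ?_
  rw [Measure.bind_apply hs τ.aemeasurable, Measure.bind_apply hs τ.aemeasurable]
  exact lintegral_mono' h le_rfl

lemma comp_univ {Z : Type*} [MeasurableSpace Z] (τ : Kernel X Z) [IsMarkovKernel τ]
    (μ : Measure X) : (τ ∘ₘ μ) Set.univ = μ Set.univ := by
  rw [Measure.bind_apply MeasurableSet.univ τ.aemeasurable]
  simp

variable {C : Set X} {τ : Kernel X X} {ν : Measure X}

lemma comp_compl_eq_zero (hC : MeasurableSet C) (hτ : ∀ x ∈ C, τ x Cᶜ = 0) {μ : Measure X}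
    (hμ : μ Cᶜ = 0) : (τ ∘ₘ μ) Cᶜ = 0 := by
  rw [Measure.bind_apply hC.compl τ.aemeasurable]
  have : ∀ᵐ x ∂μ, τ x Cᶜ = 0 := by
    have : ∀ᵐ x ∂μ, x ∈ C := hμ
    filter_upwards [this] with x hx using hτ x hx
  rw [lintegral_congr_ae this]
  simp

lemma smul_le_comp (hν : ∀ x ∈ C, ν ≤ τ x) {μ : Measure X} (hμ : μ Cᶜ = 0) :
    μ Set.univ • ν ≤ τ ∘ₘ μ := by
  refine Measure.le_iff.2 fun s hs => ?_
  rw [Measure.bind_apply hs τ.aemeasurable, Measure.smul_apply, smul_eq_mul, mul_comm,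
    ← lintegral_const]
  have : ∀ᵐ x ∂μ, x ∈ C := hμ
  refine lintegral_mono_ae ?_
  filter_upwards [this] with x hx using hν x hx s

/-- A minorized kernel splits into the minorizing part and a remainder. -/
lemma exists_comp_eq_add [IsMarkovKernel τ] (hC : MeasurableSet C) (hτ : ∀ x ∈ C, τ x Cᶜ = 0)
    [IsFiniteMeasure ν] (hν : ∀ x ∈ C, ν ≤ τ x)
    (μ : Measure X) [IsFiniteMeasure μ] (hμ : μ Cᶜ = 0) :
    ∃ r : Measure X, τ ∘ₘ μ = r + μ Set.univ • ν ∧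
      r Set.univ = μ Set.univ * (1 - ν Set.univ) ∧ r Cᶜ = 0 := by
  have hle := smul_le_comp hν hμ
  have hfin : IsFiniteMeasure (μ Set.univ • ν) := Measure.smul_finite ν (measure_ne_top _ _)
  refine ⟨τ ∘ₘ μ - μ Set.univ • ν, (Measure.sub_add_cancel_of_le hle).symm, ?_, ?_⟩
  · rw [Measure.sub_apply MeasurableSet.univ hle, comp_univ, Measure.smul_apply, smul_eq_mul,
      ENNReal.mul_sub (fun _ _ => measure_ne_top _ _), mul_one]
  · exact nonpos_iff_eq_zero.1
      ((Measure.sub_le Cᶜ).trans (comp_compl_eq_zero hC hτ hμ).le)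

/-- A coupling written with measures. The two remainders have equal mass, so each emits the same
multiple of `ν` at the next step. That multiple joins the common part, and the remainders shrink by
the factor `1 - ν univ`. -/
lemma exists_coupling [IsMarkovKernel τ] (hC : MeasurableSet C) (hτ : ∀ x ∈ C, τ x Cᶜ = 0)
    [IsFiniteMeasure ν] (hν : ∀ x ∈ C, ν ≤ τ x)
    (μ μ' : Measure X) [IsProbabilityMeasure μ] [IsProbabilityMeasure μ']
    (hμ : μ Cᶜ = 0) (hμ' : μ' Cᶜ = 0) (k : ℕ) :
    ∃ σ r r' : Measure X, (fun m : Measure X => τ ∘ₘ m)^[k] μ = σ + r ∧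
      (fun m : Measure X => τ ∘ₘ m)^[k] μ' = σ + r' ∧
      r Set.univ = (1 - ν Set.univ) ^ k ∧ r' Set.univ = (1 - ν Set.univ) ^ k ∧
      r Cᶜ = 0 ∧ r' Cᶜ = 0 := by
  induction k with
  | zero => exact ⟨0, μ, μ', by simp, by simp, by simp, by simp, hμ, hμ'⟩
  | succ k ih =>
    obtain ⟨σ, r, r', h1, h2, h3, h4, h5, h6⟩ := ih
    have hlt : (1 - ν Set.univ) ^ k < ⊤ :=
      ENNReal.pow_lt_top (lt_of_le_of_lt tsub_le_self ENNReal.one_lt_top)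
    have : IsFiniteMeasure r := ⟨h3 ▸ hlt⟩
    have : IsFiniteMeasure r' := ⟨h4 ▸ hlt⟩
    obtain ⟨s, hs1, hs2, hs3⟩ := exists_comp_eq_add hC hτ hν r h5
    obtain ⟨s', hs1', hs2', hs3'⟩ := exists_comp_eq_add hC hτ hν r' h6
    refine ⟨τ ∘ₘ σ + (1 - ν Set.univ) ^ k • ν, s, s', ?_, ?_, ?_, ?_, hs3, hs3'⟩
    · rw [Function.iterate_succ_apply', h1, Measure.comp_add, hs1, h3, add_comm s, add_assoc]
    · rw [Function.iterate_succ_apply', h2, Measure.comp_add, hs1', h4, add_comm s', add_assoc]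
    · rw [hs2, h3, pow_succ]
    · rw [hs2', h4, pow_succ]

/-- Regeneration: with `τ ∘ₘ μ = R μ + μ(univ) • ν`, the stationary law is `∑ R^k ν`. Its mass is a
geometric series with sum `1`, so applying `τ` shifts the series and puts back the lost term `ν`.
Linearity of `R` is not needed. -/
lemma exists_stationary_of_minorization [IsMarkovKernel τ] (hC : MeasurableSet C)
    (hne : C.Nonempty) (hτ : ∀ x ∈ C, τ x Cᶜ = 0) (hν : ∀ x ∈ C, ν ≤ τ x)
    (hν0 : ν Set.univ ≠ 0) :
    ∃ π : Measure X, IsProbabilityMeasure π ∧ τ ∘ₘ π = π ∧ π Cᶜ = 0 := by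
  obtain ⟨x₀, hx₀⟩ := hne
  have hfin : IsFiniteMeasure ν := isFiniteMeasure_of_le _ (hν x₀ hx₀)
  have hν1 : ν Set.univ ≤ 1 := (hν x₀ hx₀ _).trans prob_le_one
  have hνC : ν Cᶜ = 0 := nonpos_iff_eq_zero.1 ((hν x₀ hx₀ Cᶜ).trans (hτ x₀ hx₀).le)
  choose! R hR1 hR2 hR3 using fun (μ : Measure X) (h : IsFiniteMeasure μ) (hμ : μ Cᶜ = 0) =>
    exists_comp_eq_add hC hτ hν μ hμ
  have hm : ∀ k, IsFiniteMeasure (R^[k] ν) ∧ (R^[k] ν) Cᶜ = 0 ∧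
      (R^[k] ν) Set.univ = ν Set.univ * (1 - ν Set.univ) ^ k := by
    intro k
    induction k with
    | zero => exact ⟨hfin, hνC, by simp⟩
    | succ k ih =>
      obtain ⟨h1, h2, h3⟩ := ih
      have h4 := hR2 _ h1 h2
      rw [Function.iterate_succ_apply']
      refine ⟨⟨?_⟩, hR3 _ h1 h2, ?_⟩
      · rw [h4]
        exact ENNReal.mul_lt_top (measure_lt_top _ _)
          (lt_of_le_of_lt tsub_le_self ENNReal.one_lt_top)
      · rw [h4, h3, pow_succ, mul_assoc]
  have hmass : ∑' k, (R^[k] ν) Set.univ = 1 := by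
    simp_rw [fun k => (hm k).2.2]
    rw [ENNReal.tsum_mul_left, ENNReal.tsum_geometric,
      ENNReal.sub_sub_cancel ENNReal.one_ne_top hν1,
      ENNReal.mul_inv_cancel hν0 (measure_ne_top _ _)]
  refine ⟨Measure.sum fun k => R^[k] ν, ⟨?_⟩, ?_, ?_⟩
  · rw [Measure.sum_apply _ MeasurableSet.univ, hmass]
  · rw [Measure.bind_sum _ _ τ.aemeasurable]
    ext s hs
    rw [Measure.sum_apply _ hs, Measure.sum_apply _ hs]
    have : ∀ k, (τ ∘ₘ (R^[k] ν)) s = (R^[k + 1] ν) s + (R^[k] ν) Set.univ * ν s := by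
      intro k
      rw [hR1 _ (hm k).1 (hm k).2.1, Function.iterate_succ_apply']
      simp
    rw [tsum_congr this, ENNReal.tsum_add, ENNReal.tsum_mul_right, hmass, one_mul, add_comm,
      (tsum_eq_zero_add' (f := fun k => (R^[k] ν) s) ENNReal.summable :)]
    rfl
  · rw [Measure.sum_apply _ hC.compl]
    simp [fun k => (hm k).2.1]

/-- Both laws are fixed by the iterates, so they share all but a mass `(1 - ν univ) ^ k` for every
`k`. Uniqueness follows by exchanging their roles. -/
lemma le_of_stationary [IsMarkovKernel τ] (hC : MeasurableSet C)
    (hne : C.Nonempty) (hτ : ∀ x ∈ C, τ x Cᶜ = 0) (hν : ∀ x ∈ C, ν ≤ τ x)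
    (hν0 : ν Set.univ ≠ 0) (π π' : Measure X) [IsProbabilityMeasure π] [IsProbabilityMeasure π']
    (hπC : π Cᶜ = 0) (hπC' : π' Cᶜ = 0) (hπ : τ ∘ₘ π = π) (hπ' : τ ∘ₘ π' = π') : π ≤ π' := by
  obtain ⟨x₀, hx₀⟩ := hne
  have hfin : IsFiniteMeasure ν := isFiniteMeasure_of_le _ (hν x₀ hx₀)
  refine Measure.le_iff.2 fun s hs => ?_
  have hlim : Tendsto (fun k : ℕ => π' s + (1 - ν Set.univ) ^ k) atTop (𝓝 (π' s + 0)) :=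
    tendsto_const_nhds.add (ENNReal.tendsto_pow_atTop_nhds_zero_of_lt_one
      (ENNReal.sub_lt_self ENNReal.one_ne_top one_ne_zero hν0))
  rw [add_zero] at hlim
  refine ge_of_tendsto' hlim fun k => ?_
  obtain ⟨σ, r, r', h1, h2, h3, -, -, -⟩ := exists_coupling hC hτ hν π π' hπC hπC' k
  rw [Function.iterate_fixed hπ] at h1
  rw [Function.iterate_fixed hπ'] at h2
  rw [h1, Measure.add_apply, h2, Measure.add_apply, ← h3]
  exact add_le_add (self_le_add_right _ _) (measure_mono (Set.subset_univ s))

/-- **Doeblin's theorem**: a Markov kernel with an iterate minorized by a nonzero measure on an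
absorbing set is uniformly ergodic there. -/
theorem exists_stationary_tendsto {κ : Kernel X X} [IsMarkovKernel κ] (hC : MeasurableSet C)
    (hne : C.Nonempty) (hκ : ∀ x ∈ C, κ x Cᶜ = 0) (N : ℕ)
    (hν : ∀ x ∈ C, ν ≤ kernelPow κ N x) (hν0 : ν Set.univ ≠ 0) :
    ∃ π : Measure X, IsProbabilityMeasure π ∧ κ ∘ₘ π = π ∧ π Cᶜ = 0 ∧
      (∀ π' : Measure X, IsProbabilityMeasure π' → κ ∘ₘ π' = π' → π' Cᶜ = 0 → π' = π) ∧
      ∀ μ : Measure X, IsProbabilityMeasure μ → μ Cᶜ = 0 → ∃ b : ℕ → ℝ≥0∞,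
        Tendsto b atTop (𝓝 0) ∧ ∀ n, ∃ σ r r' : Measure X,
          (fun m : Measure X => κ ∘ₘ m)^[n] μ = σ + r ∧ π = σ + r' ∧
          r Set.univ + r' Set.univ ≤ b n := by
  have habs : ∀ n, ∀ μ : Measure X, μ Cᶜ = 0 → ((fun m : Measure X => κ ∘ₘ m)^[n] μ) Cᶜ = 0 := by
    intro n
    induction n with
    | zero => exact fun μ h => h
    | succ n ih => exact fun μ h => ih _ (comp_compl_eq_zero hC hκ h)
  have hτ : ∀ x ∈ C, kernelPow κ N x Cᶜ = 0 := fun x hx => by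
    rw [kernelPow_apply]
    exact habs N _ (by rw [Measure.dirac_apply' _ hC.compl]; simp [hx])
  obtain ⟨x₀, hx₀⟩ := id hne
  have hfin : IsFiniteMeasure ν := isFiniteMeasure_of_le _ (hν x₀ hx₀)
  obtain ⟨π, hπ1, hπ2, hπ3⟩ := exists_stationary_of_minorization hC hne hτ hν hν0
  have huniq : ∀ π' : Measure X, IsProbabilityMeasure π' → kernelPow κ N ∘ₘ π' = π' →
      π' Cᶜ = 0 → π' = π := fun π' h1 h2 h3 =>
    le_antisymm (le_of_stationary hC hne hτ hν hν0 π' π h3 hπ3 h2 hπ2)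
      (le_of_stationary hC hne hτ hν hν0 π π' hπ3 h3 hπ2 h2)
  -- `κ` commutes with its `N`-th iterate, so `κ ∘ₘ π` is again stationary for that iterate and
  -- uniqueness applies.
  have hstat : κ ∘ₘ π = π := by
    refine huniq _ inferInstance ?_ (comp_compl_eq_zero hC hκ hπ3)
    rw [kernelPow_comp] at hπ2 ⊢
    rw [← Function.iterate_succ_apply (fun m : Measure X => κ ∘ₘ m), Function.iterate_succ_apply',
      hπ2]
  refine ⟨π, hπ1, hstat, hπ3, fun π' h1 h2 h3 => huniq π' h1 ?_ h3, fun μ hμ1 hμ2 => ?_⟩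
  · rw [kernelPow_comp]
    exact Function.iterate_fixed h2 N
  have hN : ∀ k, (fun m : Measure X => kernelPow κ N ∘ₘ m)^[k] =
      (fun m : Measure X => κ ∘ₘ m)^[N * k] := fun k => by
    rw [Function.iterate_mul]
    congr 1
    funext m
    exact kernelPow_comp κ N m
  -- For `N = 0` the minorized iterate is the identity, so uniqueness forces every probability
  -- measure carried by `C` to equal `π`.
  by_cases hN0 : N = 0
  · subst hN0
    have h : μ = π := huniq μ hμ1 (by rw [kernelPow_comp]; rfl) hμ2
    refine ⟨0, tendsto_const_nhds, fun n => ⟨π, 0, 0, ?_, by simp, by simp⟩⟩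
    rw [h, Function.iterate_fixed hstat, add_zero]
  refine ⟨fun n => 2 * (1 - ν Set.univ) ^ (n / N), ?_, fun n => ?_⟩
  · have h1 : Tendsto (fun k : ℕ => (1 - ν Set.univ) ^ k) atTop (𝓝 0) :=
      ENNReal.tendsto_pow_atTop_nhds_zero_of_lt_one
        (ENNReal.sub_lt_self ENNReal.one_ne_top one_ne_zero hν0)
    have h2 := ENNReal.Tendsto.const_mul (a := 2)
      (h1.comp (Nat.tendsto_div_const_atTop hN0)) (Or.inr (by simp))
    simpa using h2
  · obtain ⟨σ, r, r', h1, h2, h3, h4, -, -⟩ :=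
      exists_coupling hC hτ hν μ π hμ2 hπ3 (n / N)
    -- The splitting obtained after `n / N` blocks is pushed through the `n % N` leftover steps,
    -- which preserve masses.
    refine ⟨kernelPow κ (n % N) ∘ₘ σ, kernelPow κ (n % N) ∘ₘ r, kernelPow κ (n % N) ∘ₘ r',
      ?_, ?_, ?_⟩
    · rw [← Measure.comp_add, ← h1, kernelPow_comp, hN, ← Function.iterate_add_apply,
        Nat.mod_add_div]
    · rw [← Measure.comp_add, ← h2, hN, Function.iterate_fixed hstat, kernelPow_comp,
        Function.iterate_fixed hstat]
    · rw [comp_univ, comp_univ, h3, h4, ← two_mul]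

end Doeblin

/-! ### Haar lower bounds carried along noiseless orbits. -/

section Minorization

lemma measure_smul_le_comp {X Z : Type*} [MeasurableSpace X] [MeasurableSpace Z]
    {τ : Kernel X Z} {ν : Measure Z} {A : Set X} (hA : MeasurableSet A)
    (hν : ∀ x ∈ A, ν ≤ τ x) (μ : Measure X) : μ A • ν ≤ τ ∘ₘ μ := by
  refine Measure.le_iff.2 fun s hs => ?_
  rw [Measure.bind_apply hs τ.aemeasurable, Measure.smul_apply, smul_eq_mul, mul_comm,
    ← setLIntegral_const]
  exact (setLIntegral_mono' hA fun x hx => hν x hx s).trans (setLIntegral_le_lintegral _ _)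

lemma smul_measure_mono {X : Type*} [MeasurableSpace X] {a b : ℝ≥0∞} {μ ν : Measure X}
    (hab : a ≤ b) (hμν : μ ≤ ν) : a • μ ≤ b • ν :=
  Measure.le_iff.2 fun s _ => by
    simpa only [Measure.smul_apply, smul_eq_mul] using mul_le_mul' hab (hμν s)

/-- Regrouping the factors so that each round ends with the diffusive kernel `κ₁`: a Haar lower
bound is then available between rounds. -/
lemma iterate_comp_succ {X : Type*} [MeasurableSpace X] {κ₁ κ₂ : Kernel X X}
    (x : X) (N : ℕ) :
    kernelPow (κ₂ ∘ₖ κ₁) (N + 1) x =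
      κ₂ ∘ₘ ((fun m : Measure X => κ₁ ∘ₘ (κ₂ ∘ₘ m))^[N] (κ₁ x)) := by
  induction N with
  | zero => simp [kernelPow, Kernel.comp_apply]
  | succ N ih =>
    rw [kernelPow, Kernel.comp_apply, ih, Function.iterate_succ_apply', ← Measure.comp_assoc]

variable {X : Type*} [MetricSpace X] [MeasurableSpace X] [OpensMeasurableSpace X]
  {ρ : Measure X} {κ₁ κ₂ : Kernel X X} {T : X → X} {α : ℝ} {ε δ : ℝ≥0∞}

/-- If `u` is within `α / 2` of `T x`, the ball of radius `α` about `u` contains the ball of radius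
`α / 2` about `T x`. -/
lemma smul_restrict_ball_le_comp
    (h₁ : ∀ x, ε • ρ.restrict (Metric.ball x α) ≤ κ₁ x)
    (h₂ : ∀ x, δ ≤ κ₂ x (Metric.ball (T x) (α / 2))) (x : X) :
    δ • ε • ρ.restrict (Metric.ball (T x) (α / 2)) ≤ κ₁ ∘ₘ κ₂ x := by
  refine (smul_measure_mono (h₂ x) le_rfl).trans
    (measure_smul_le_comp Metric.isOpen_ball.measurableSet (fun u hu => ?_) (κ₂ x))
  refine (smul_measure_mono le_rfl (Measure.restrict_mono (fun z hz => ?_) le_rfl)).trans (h₁ u)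
  rw [Metric.mem_ball] at *
  have := dist_triangle_right z u (T x)
  linarith

/-- One round moves a Haar lower bound from `y` to `T y`. However small `r` is, the new radius is `α
/ 4`: shrinking costs only the constant, and the diffusion restores the radius. The constant is
independent of `m`. -/
lemma exists_smul_restrict_ball_le_comp [ρ.IsOpenPosMeasure] (hT : Continuous T)
    (hα : 0 < α) (hε : ε ≠ 0) (hδ : δ ≠ 0)
    (h₁ : ∀ x, ε • ρ.restrict (Metric.ball x α) ≤ κ₁ x)
    (h₂ : ∀ x, δ ≤ κ₂ x (Metric.ball (T x) (α / 2))) (y : X) {r : ℝ} (hr : 0 < r)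
    {c : ℝ≥0∞} (hc : c ≠ 0) :
    ∃ c' : ℝ≥0∞, c' ≠ 0 ∧ ∀ m : Measure X, c • ρ.restrict (Metric.ball y r) ≤ m →
      c' • ρ.restrict (Metric.ball (T y) (α / 4)) ≤ κ₁ ∘ₘ (κ₂ ∘ₘ m) := by
  obtain ⟨r₁, hr₁, hT₁⟩ := Metric.continuous_iff.1 hT y (α / 4) (by positivity)
  set A := Metric.ball y (min r r₁) with hA
  have hA0 : ρ A ≠ 0 :=
    (Metric.isOpen_ball.measure_pos ρ (Metric.nonempty_ball.2 (lt_min hr hr₁))).ne'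
  refine ⟨c * ρ A * δ * ε, by positivity, fun m hm => ?_⟩
  have hmA : c * ρ A ≤ m A := by
    refine le_trans ?_ (hm A)
    rw [Measure.smul_apply, smul_eq_mul, Measure.restrict_apply Metric.isOpen_ball.measurableSet,
      Set.inter_eq_left.2 (Metric.ball_subset_ball (min_le_left r r₁))]
  rw [mul_assoc (c * ρ A), mul_smul (c * ρ A), mul_smul δ, Measure.comp_assoc]
  refine (smul_measure_mono (X := X) hmA le_rfl).trans
    (measure_smul_le_comp Metric.isOpen_ball.measurableSet (fun z hz => ?_) m)
  rw [Kernel.comp_apply]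
  refine le_trans ?_ (smul_restrict_ball_le_comp h₁ h₂ z)
  refine smul_measure_mono le_rfl (smul_measure_mono le_rfl
    (Measure.restrict_mono (fun u hu => ?_) le_rfl))
  have hz' := hT₁ z (lt_of_lt_of_le (Metric.mem_ball.1 hz) (min_le_right _ _))
  rw [Metric.mem_ball] at *
  have := dist_triangle_right u (T z) (T y)
  linarith

/-- Minorization near a point from which a noiseless orbit converging to `e` is reachable. -/
lemma exists_nhds_minorization [ρ.IsOpenPosMeasure] (hT : Continuous T)
    (hα : 0 < α) (hε : ε ≠ 0) (hδ : δ ≠ 0)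
    (h₁ : ∀ x, ε • ρ.restrict (Metric.ball x α) ≤ κ₁ x)
    (h₂ : ∀ x, δ ≤ κ₂ x (Metric.ball (T x) (α / 2))) {e x γ : X} (hγ : dist γ x < α)
    (hlim : Tendsto (fun n => T^[n] γ) atTop (𝓝 e)) :
    ∃ U ∈ 𝓝 x, ∃ N₀ : ℕ, ∀ N ≥ N₀, ∃ c : ℝ≥0∞, c ≠ 0 ∧ ∀ x' ∈ U,
      c • ρ.restrict (Metric.ball e (α / 8)) ≤
        (fun m : Measure X => κ₁ ∘ₘ (κ₂ ∘ₘ m))^[N + 1] (κ₁ x') := by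
  -- Half of the slack goes to the variation of the starting point around `x`, half to a ball around
  -- `γ`: the latter then lies in the ball of radius `α` about each such starting point.
  have hr : 0 < (α - dist γ x) / 2 := by linarith
  refine ⟨Metric.ball x ((α - dist γ x) / 2), Metric.ball_mem_nhds x hr, ?_⟩
  have key : ∀ N : ℕ, ∃ c : ℝ≥0∞, c ≠ 0 ∧ ∀ x' ∈ Metric.ball x ((α - dist γ x) / 2),
      c • ρ.restrict (Metric.ball (T^[N + 1] γ) (α / 4)) ≤
        (fun m : Measure X => κ₁ ∘ₘ (κ₂ ∘ₘ m))^[N + 1] (κ₁ x') := by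
    intro N
    induction N with
    | zero =>
      obtain ⟨c, hc, h⟩ := exists_smul_restrict_ball_le_comp hT hα hε hδ h₁ h₂ γ hr hε
      refine ⟨c, hc, fun x' hx' => h _ (le_trans ?_ (h₁ x'))⟩
      refine smul_measure_mono le_rfl (Measure.restrict_mono (fun z hz => ?_) le_rfl)
      rw [Metric.mem_ball] at *
      have h3 := dist_triangle z γ x'
      have h4 := dist_triangle_right γ x' x
      linarith
    | succ N ih =>
      obtain ⟨c, hc, h⟩ := ih
      obtain ⟨c', hc', h'⟩ := exists_smul_restrict_ball_le_comp hT hα hε hδ h₁ h₂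
        (T^[N + 1] γ) (by positivity : 0 < α / 4) hc
      refine ⟨c', hc', fun x' hx' => ?_⟩
      rw [Function.iterate_succ_apply' _ (N + 1), Function.iterate_succ_apply' _ (N + 1)]
      exact h' _ (h x' hx')
  obtain ⟨N₀, hN₀⟩ := Metric.tendsto_atTop.1 hlim (α / 8) (by positivity)
  refine ⟨N₀, fun N hN => ?_⟩
  obtain ⟨c, hc, h⟩ := key N
  refine ⟨c, hc, fun x' hx' => le_trans ?_ (h x' hx')⟩
  refine smul_measure_mono le_rfl (Measure.restrict_mono (fun z hz => ?_) le_rfl)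
  have h5 := hN₀ (N + 1) (by omega)
  rw [Metric.mem_ball] at *
  have := dist_triangle_right z (T^[N + 1] γ) e
  linarith

/-- The local bounds all concern the same ball around `e`, so a finite subcover suffices, with the
smallest constant. Validity for all `N ≥ N₀` lets the finitely many neighbourhoods share one `N`. -/
theorem exists_minorization [ρ.IsOpenPosMeasure] [IsMarkovKernel κ₂] (hT : Continuous T)
    (hα : 0 < α) (hε : ε ≠ 0) (hδ : δ ≠ 0)
    (h₁ : ∀ x, ε • ρ.restrict (Metric.ball x α) ≤ κ₁ x)
    (h₂ : ∀ x, δ ≤ κ₂ x (Metric.ball (T x) (α / 2))) {e : X} {C : Set X} (hC : IsCompact C)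
    (hlim : ∀ x ∈ C, ∃ γ, dist γ x < α ∧ Tendsto (fun n => T^[n] γ) atTop (𝓝 e)) :
    ∃ (N : ℕ) (ν : Measure X), ν Set.univ ≠ 0 ∧ ∀ x ∈ C, ν ≤ kernelPow (κ₂ ∘ₖ κ₁) N x := by
  have key : ∃ N₀ : ℕ, ∀ N ≥ N₀, ∃ c : ℝ≥0∞, c ≠ 0 ∧ ∀ x ∈ C,
      c • ρ.restrict (Metric.ball e (α / 8)) ≤
        (fun m : Measure X => κ₁ ∘ₘ (κ₂ ∘ₘ m))^[N + 1] (κ₁ x) := by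
    refine hC.induction_on (p := fun S => ∃ N₀ : ℕ, ∀ N ≥ N₀, ∃ c : ℝ≥0∞, c ≠ 0 ∧ ∀ x ∈ S,
      c • ρ.restrict (Metric.ball e (α / 8)) ≤
        (fun m : Measure X => κ₁ ∘ₘ (κ₂ ∘ₘ m))^[N + 1] (κ₁ x)) ?_ ?_ ?_ ?_
    · exact ⟨0, fun _ _ => ⟨1, one_ne_zero, by simp⟩⟩
    · rintro s t hst ⟨N₀, h⟩
      refine ⟨N₀, fun N hN => ?_⟩
      obtain ⟨c, hc, h'⟩ := h N hN
      exact ⟨c, hc, fun x hx => h' x (hst hx)⟩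
    · rintro s t ⟨N₀, h⟩ ⟨N₁, h'⟩
      refine ⟨max N₀ N₁, fun N hN => ?_⟩
      obtain ⟨c, hc, hs⟩ := h N ((le_max_left _ _).trans hN)
      obtain ⟨c', hc', ht⟩ := h' N ((le_max_right _ _).trans hN)
      refine ⟨min c c', (lt_min (pos_iff_ne_zero.2 hc) (pos_iff_ne_zero.2 hc')).ne', ?_⟩
      rintro x (hx | hx)
      · exact (smul_measure_mono (min_le_left _ _) le_rfl).trans (hs x hx)
      · exact (smul_measure_mono (min_le_right _ _) le_rfl).trans (ht x hx)
    · intro x hx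
      obtain ⟨γ, hγ, hγ'⟩ := hlim x hx
      obtain ⟨U, hU, h⟩ := exists_nhds_minorization hT hα hε hδ h₁ h₂ hγ hγ'
      exact ⟨U, mem_nhdsWithin_of_mem_nhds hU, h⟩
  obtain ⟨N₀, h⟩ := key
  obtain ⟨c, hc, h⟩ := h N₀ le_rfl
  refine ⟨N₀ + 1 + 1, κ₂ ∘ₘ (c • ρ.restrict (Metric.ball e (α / 8))), ?_, fun x hx => ?_⟩
  · rw [comp_univ, Measure.smul_apply, smul_eq_mul, Measure.restrict_apply_univ]
    exact mul_ne_zero hc (Metric.isOpen_ball.measure_pos ρ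
      (Metric.nonempty_ball.2 (by positivity))).ne'
  · rw [iterate_comp_succ]
    exact comp_mono κ₂ (h x hx)

end Minorization

/-! ### Kernels driven by an independent noise. -/

section NoiseKernel

variable {X Z T : Type*} [MeasurableSpace X] [MeasurableSpace Z] [MeasurableSpace T]

/-- The kernel `x ↦ law of f (x, ξ)` for a noise `ξ` of law `μ`. -/
noncomputable def noiseKernel (f : X × Z → T) (hf : Measurable f) (μ : Measure Z) [SFinite μ] :
    Kernel X T where
  toFun x := μ.map fun z => f (x, z)
  measurable' := by
    refine Measure.measurable_of_measurable_coe _ fun s hs => ?_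
    have : ∀ x : X, (μ.map fun z => f (x, z)) s = μ (Prod.mk x ⁻¹' (f ⁻¹' s)) := fun x =>
      Measure.map_apply (hf.comp measurable_prodMk_left) hs
    rw [funext this]
    exact measurable_measure_prodMk_left (hf hs)

variable {f : X × Z → T} (hf : Measurable f) (μ : Measure Z)

lemma noiseKernel_apply [SFinite μ] (x : X) :
    noiseKernel f hf μ x = μ.map fun z => f (x, z) := rfl

lemma noiseKernel_apply' [SFinite μ] (x : X) {s : Set T} (hs : MeasurableSet s) :
    noiseKernel f hf μ x s = μ {z | f (x, z) ∈ s} :=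
  Measure.map_apply (hf.comp measurable_prodMk_left) hs

instance [IsProbabilityMeasure μ] : IsMarkovKernel (noiseKernel f hf μ) :=
  ⟨fun _ => Measure.isProbabilityMeasure_map (hf.comp measurable_prodMk_left).aemeasurable⟩

end NoiseKernel

/-! ### The error chain as diffusion followed by correction. -/

section ErrorChain

lemma rightHaar_isOpenPosMeasure {G : Type*} [Group G] [TopologicalSpace G]
    [IsTopologicalGroup G] [LocallyCompactSpace G] [MeasurableSpace G] [BorelSpace G] :
    (rightHaar G).IsOpenPosMeasure := by
  unfold rightHaar; infer_instance

/-- Near any point of `C` the interior of `C` contains a nonempty open set, which has positive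
measure and so is not inside the exceptional null set. -/
lemma exists_dist_lt_of_ae_restrict {X : Type*} [MetricSpace X] [MeasurableSpace X]
    [OpensMeasurableSpace X] {ρ : Measure X} [ρ.IsOpenPosMeasure] {C : Set X}
    (hC : C = closure (interior C)) {q : X → Prop} (hq : ∀ᵐ γ ∂(ρ.restrict C), q γ)
    {x : X} (hx : x ∈ C) {α : ℝ} (hα : 0 < α) : ∃ γ, dist γ x < α ∧ q γ := by
  rw [hC] at hx
  obtain ⟨y, hy, hxy⟩ := Metric.mem_closure_iff.1 hx α hα
  set U := interior C ∩ Metric.ball x α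
  have hU : IsOpen U := isOpen_interior.inter Metric.isOpen_ball
  have hU0 : ρ U ≠ 0 :=
    (hU.measure_pos ρ ⟨y, hy, Metric.mem_ball.2 (by rwa [dist_comm])⟩).ne'
  have hqU : ∀ᵐ γ ∂ρ, γ ∈ U → q γ := (ae_restrict_iff' hU.measurableSet).1
    (ae_mono (Measure.restrict_mono (Set.inter_subset_left.trans interior_subset) le_rfl) hq)
  by_contra! hcon
  refine hU0 (measure_mono_null (fun γ hγ => ?_) hqU)
  exact fun hh => hcon γ (Metric.mem_ball.1 hγ.2) (hh hγ)

variable {G Y : Type*} {p : ℕ} [Group G] [MetricSpace G] [IsTopologicalGroup G]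
  [SecondCountableTopology G] [MeasurableSpace G] [BorelSpace G] [MeasurableSpace Y]
  {h : G → Noise p → Y} {K : Y → G} {Υ : G}

lemma measurable_correct (h_meas : Measurable (Function.uncurry h)) (K_meas : Measurable K) :
    Measurable (Function.uncurry (correct K h)) := by
  have : Function.uncurry (correct K h) = fun z : G × Noise p =>
      z.1 * (K (Function.uncurry h z))⁻¹ := rfl
  rw [this]
  fun_prop

lemma measurable_conj_correct (h_meas : Measurable (Function.uncurry h))
    (K_meas : Measurable K) (Υ : G) :
    Measurable fun z : G × Noise p => correct K h (Υ * z.1 * Υ⁻¹) z.2 :=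
  (measurable_correct h_meas K_meas).comp (f := fun z : G × Noise p => (Υ * z.1 * Υ⁻¹, z.2))
    (by fun_prop)

lemma measurable_errorStep (h_meas : Measurable (Function.uncurry h))
    (K_meas : Measurable K) (Υ : G) :
    Measurable fun z : G × G × Noise p => errorStep Υ K h z.1 z.2.1 z.2.2 :=
  (measurable_correct h_meas K_meas).comp
    (f := fun z : G × G × Noise p => (Υ * z.2.1 * z.1 * Υ⁻¹, z.2.2)) (by fun_prop)

/-- The kernel `x ↦ law of w x`. -/
noncomputable def walkKernel (lawW : Measure G) [SFinite lawW] : Kernel G G :=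
  noiseKernel (fun z : G × G => z.2 * z.1) (by fun_prop) lawW

instance (lawW : Measure G) [IsProbabilityMeasure lawW] : IsMarkovKernel (walkKernel lawW) := by
  unfold walkKernel; infer_instance

/-- The kernel `z ↦ law of the correction of Υ z Υ⁻¹`. -/
noncomputable def correctKernel (h_meas : Measurable (Function.uncurry h))
    (K_meas : Measurable K) (Υ : G) (lawV : Measure (Noise p)) [SFinite lawV] : Kernel G G :=
  noiseKernel _ (measurable_conj_correct h_meas K_meas Υ) lawV

instance (h_meas : Measurable (Function.uncurry h)) (K_meas : Measurable K)
    (lawV : Measure (Noise p)) [IsProbabilityMeasure lawV] :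
    IsMarkovKernel (correctKernel h_meas K_meas Υ lawV) := by
  unfold correctKernel; infer_instance

lemma nextLaw_apply (h_meas : Measurable (Function.uncurry h)) (K_meas : Measurable K)
    (lawW : Measure G) [SFinite lawW] (lawV : Measure (Noise p)) [SFinite lawV]
    (μ : Measure G) {s : Set G} (hs : MeasurableSet s) :
    nextLaw Υ K h lawW lawV μ s =
      ∫⁻ x, ∫⁻ w, lawV {v | errorStep Υ K h x w v ∈ s} ∂lawW ∂μ := by
  have hm := measurable_errorStep h_meas K_meas Υ
  rw [nextLaw, Measure.map_apply hm hs, Measure.prod_apply (hm hs)]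
  refine lintegral_congr fun x => ?_
  exact Measure.prod_apply (measurable_prodMk_left (hm hs))

/-- Conjugation by `Υ` is grouped with the correction. The first factor is then a pure translation
by noise, and the noiseless version of the second is exactly `noiselessStep`. -/
lemma nextLaw_eq_comp (h_meas : Measurable (Function.uncurry h)) (K_meas : Measurable K)
    (lawW : Measure G) [SFinite lawW] (lawV : Measure (Noise p)) [SFinite lawV]
    (μ : Measure G) :
    nextLaw Υ K h lawW lawV μ =
      (correctKernel h_meas K_meas Υ lawV ∘ₖ walkKernel lawW) ∘ₘ μ := by
  ext s hs
  rw [nextLaw_apply h_meas K_meas lawW lawV μ hs, Measure.bind_apply hs (Kernel.aemeasurable _)]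
  refine lintegral_congr fun x => ?_
  rw [Kernel.comp_apply' _ _ _ hs, walkKernel, noiseKernel_apply,
    lintegral_map (Kernel.measurable_coe _ hs) (by fun_prop)]
  refine lintegral_congr fun w => ?_
  rw [correctKernel, noiseKernel_apply' _ _ _ hs]
  simp only [errorStep, mul_assoc]

lemma errorLaw_eq_iterate (h_meas : Measurable (Function.uncurry h)) (K_meas : Measurable K)
    (lawW : Measure G) [SFinite lawW] (lawV : Measure (Noise p)) [SFinite lawV]
    (μ : Measure G) (n : ℕ) :
    errorLaw Υ K h lawW lawV μ n = (fun m : Measure G =>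
      (correctKernel h_meas K_meas Υ lawV ∘ₖ walkKernel lawW) ∘ₘ m)^[n] μ := by
  induction n with
  | zero => rfl
  | succ n ih =>
    rw [Function.iterate_succ_apply', ← ih, errorLaw, nextLaw_eq_comp h_meas K_meas]

/-- Right translation by `x` preserves both the distance and `rightHaar`, so it carries the density
bound from the ball about `1` to the ball about `x`. -/
lemma smul_restrict_ball_le_walkKernel [LocallyCompactSpace G]
    (dist_right : ∀ x y g : G, dist (x * g) (y * g) = dist x y)
    (lawW : Measure G) [SFinite lawW] {α ε : ℝ}
    (hε : ∀ᵐ g ∂((rightHaar G).restrict (Metric.ball 1 α)),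
      ENNReal.ofReal ε ≤ lawW.rnDeriv (rightHaar G) g) (x : G) :
    ENNReal.ofReal ε • (rightHaar G).restrict (Metric.ball x α) ≤ walkKernel lawW x := by
  have hinv : (rightHaar G).IsMulRightInvariant := by unfold rightHaar; infer_instance
  refine Measure.le_iff.2 fun s hs => ?_
  have hpre : (fun w : G => w * x) ⁻¹' (s ∩ Metric.ball x α) =
      {w | w * x ∈ s} ∩ Metric.ball 1 α := by
    ext w
    have : dist (w * x) x = dist w 1 := by simpa using dist_right w 1 x
    simp [this]
  have hms : MeasurableSet {w : G | w * x ∈ s} := (measurable_mul_const x) hs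
  rw [walkKernel, noiseKernel_apply' _ _ _ hs, Measure.smul_apply, smul_eq_mul,
    Measure.restrict_apply hs, ← measure_preimage_mul_right (rightHaar G) x, hpre]
  calc ENNReal.ofReal ε * rightHaar G ({w | w * x ∈ s} ∩ Metric.ball 1 α)
      = ∫⁻ _ in {w | w * x ∈ s} ∩ Metric.ball 1 α, ENNReal.ofReal ε ∂(rightHaar G) := by
        rw [setLIntegral_const]
    _ ≤ ∫⁻ w in {w | w * x ∈ s} ∩ Metric.ball 1 α,
          lawW.rnDeriv (rightHaar G) w ∂(rightHaar G) :=
        lintegral_mono_ae (ae_mono (Measure.restrict_mono Set.inter_subset_right le_rfl) hε)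
    _ ≤ lawW ({w | w * x ∈ s} ∩ Metric.ball 1 α) := Measure.setLIntegral_rnDeriv_le _
    _ ≤ lawW {w | w * x ∈ s} := measure_mono Set.inter_subset_left

end ErrorChain

/-! ### From the filter to the autonomous error chain. -/

section Filter

/-- One step of the joint evolution of state and estimate, with right-hand input `u`. -/
def runStep {G Y : Type*} {p : ℕ} [Group G] [MulAction G Y] (Υ : G) (K : Y → G) (h : G → Noise p → Y) (u : G) (s : G × G)
    (z : G × Noise p) : G × G :=
  (Υ * z.1 * s.1 * u, K ((Υ * s.2 * u) • h (Υ * z.1 * s.1 * u) z.2) * (Υ * s.2 * u))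

lemma IsFilterRun.succ_eq {G Y Ω : Type*} {p : ℕ} [Group G] [MulAction G Y] [MeasurableSpace G]
    [MeasurableSpace Ω] {h : G → Noise p → Y} {K : Y → G} {Υ : G} {lawW : Measure G}
    {lawV : Measure (Noise p)} {inp : ℕ → G} {P : Measure Ω} {W : ℕ → Ω → G}
    {V : ℕ → Ω → Noise p} {χ : ℕ → Ω → G} {out : ℕ → Ω → Y} {pred est : ℕ → Ω → G}
    (hrun : IsFilterRun Υ K h lawW lawV inp P W V χ out pred est)
    (n : ℕ) (ω : Ω) : (χ (n + 1) ω, est (n + 1) ω) =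
      runStep Υ K h (inp n) (χ n ω, est n ω) (W n ω, V (n + 1) ω) := by
  simp only [runStep, hrun.update, hrun.output, hrun.predict, hrun.state]

variable {G Y Ω : Type*} {p : ℕ} [Group G] [MetricSpace G] [IsTopologicalGroup G]
  [SecondCountableTopology G] [MeasurableSpace G] [BorelSpace G] [MeasurableSpace Y]
  [MulAction G Y] [MeasurableSMul₂ G Y] [MeasurableSpace Ω]
  {h : G → Noise p → Y} {K : Y → G} {Υ : G} {lawW : Measure G} {lawV : Measure (Noise p)}
  {inp : ℕ → G} {P : Measure Ω} {W : ℕ → Ω → G} {V : ℕ → Ω → Noise p} {χ : ℕ → Ω → G}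
  {out : ℕ → Ω → Y} {pred est : ℕ → Ω → G}

lemma measurable_runStep (h_meas : Measurable (Function.uncurry h)) (K_meas : Measurable K)
    (u : G) : Measurable fun q : (G × G) × G × Noise p => runStep Υ K h u q.1 q.2 := by
  have h1 : Measurable fun q : (G × G) × G × Noise p => h (Υ * q.2.1 * q.1.1 * u) q.2.2 :=
    h_meas.comp (f := fun q : (G × G) × G × Noise p => (Υ * q.2.1 * q.1.1 * u, q.2.2))
      (by fun_prop)
  have h2 : Measurable fun q : (G × G) × G × Noise p => Υ * q.1.2 * u := by fun_prop
  have h3 : Measurable fun q : (G × G) × G × Noise p => Υ * q.2.1 * q.1.1 * u := by fun_prop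
  exact h3.prodMk ((K_meas.comp (h2.smul h1)).mul h2)

/-- The state and the estimate are a function of the initial ones and of the past noise. -/
lemma IsFilterRun.exists_eq (hrun : IsFilterRun Υ K h lawW lawV inp P W V χ out pred est)
    (h_meas : Measurable (Function.uncurry h)) (K_meas : Measurable K) (n : ℕ) :
    ∃ F : (G × G) × (Finset.range n → G × Noise p) → G × G, Measurable F ∧
      ∀ ω, (χ n ω, est n ω) = F ((χ 0 ω, est 0 ω), fun i => (W i ω, V (i + 1) ω)) := by
  induction n with
  | zero => exact ⟨fun q => q.1, measurable_fst, fun ω => rfl⟩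
  | succ n ih =>
    obtain ⟨F, hF, hF'⟩ := ih
    refine ⟨fun q => runStep Υ K h (inp n)
      (F (q.1, fun i => q.2 ⟨i, Finset.range_subset_range.2 n.le_succ i.2⟩))
      (q.2 ⟨n, Finset.self_mem_range_succ n⟩), ?_, fun ω => ?_⟩
    · refine (measurable_runStep (Υ := Υ) h_meas K_meas (inp n)).comp (Measurable.prodMk ?_ ?_)
      · exact hF.comp (measurable_fst.prodMk
          (measurable_pi_lambda _ fun i => (measurable_pi_apply _).comp measurable_snd))
      · exact (measurable_pi_apply _).comp measurable_snd
    · rw [hrun.succ_eq, hF']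

/-- The joint law of the triple is a triple product, and products of measures are associative. It is
used with initial data, past noise and current noise. -/
lemma indepFun_prodMk_left {α β γ : Type*} [MeasurableSpace α] [MeasurableSpace β]
    [MeasurableSpace γ] [IsProbabilityMeasure P] {A : Ω → α} {B : Ω → β} {D : Ω → γ}
    (hA : Measurable A) (hB : Measurable B) (hD : Measurable D)
    (h1 : IndepFun A (fun ω => (B ω, D ω)) P) (h2 : IndepFun B D P) :
    IndepFun (fun ω => (A ω, B ω)) D P := by
  have hAB : IndepFun A B P := h1.comp measurable_id measurable_fst
  have := Measure.isProbabilityMeasure_map (μ := P) hA.aemeasurable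
  have := Measure.isProbabilityMeasure_map (μ := P) hB.aemeasurable
  have := Measure.isProbabilityMeasure_map (μ := P) hD.aemeasurable
  rw [indepFun_iff_map_prod_eq_prod_map_map (by fun_prop) (by fun_prop)] at *
  refine MeasurableEquiv.map_measurableEquiv_injective MeasurableEquiv.prodAssoc ?_
  rw [hAB, Measure.prodAssoc_prod, ← h2, ← h1, Measure.map_map (by fun_prop) (by fun_prop)]
  rfl

lemma IsFilterRun.indepFun (hrun : IsFilterRun Υ K h lawW lawV inp P W V χ out pred est)
    [IsProbabilityMeasure P]
    (h_meas : Measurable (Function.uncurry h)) (K_meas : Measurable K) (n : ℕ) :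
    IndepFun (fun ω => (χ n ω, est n ω)) (fun ω => (W n ω, V (n + 1) ω)) P := by
  obtain ⟨F, hF, hF'⟩ := hrun.exists_eq h_meas K_meas n
  have hZ : ∀ i, Measurable fun ω => (W i ω, V (i + 1) ω) := fun i =>
    (hrun.measurable_W i).prodMk (hrun.measurable_V (i + 1))
  have h1 := hrun.noise_indep.indepFun_finset (Finset.range n) {n} (by simp) hZ
  have h2 : IndepFun (fun ω (i : Finset.range n) => (W i ω, V (i + 1) ω))
      (fun ω => (W n ω, V (n + 1) ω)) P :=
    h1.comp measurable_id (measurable_pi_apply (⟨n, Finset.mem_singleton_self n⟩ : ({n} : Finset ℕ)))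
  have h3 : IndepFun (fun ω => (χ 0 ω, est 0 ω)) (fun ω =>
      ((fun i : Finset.range n => (W i ω, V (i + 1) ω)), (W n ω, V (n + 1) ω))) P :=
    hrun.init_indep.comp (ψ := fun z : ℕ → G × Noise p =>
      ((fun i : Finset.range n => z i), z n)) measurable_id
      ((measurable_pi_lambda _ fun i => measurable_pi_apply _).prodMk (measurable_pi_apply n))
  have h4 := indepFun_prodMk_left (hrun.measurable_init.1.prodMk hrun.measurable_init.2)
    (measurable_pi_lambda _ fun i : Finset.range n => hZ i) (hZ n) h3 h2
  have h5 := h4.comp hF measurable_id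
  rw [funext hF']
  exact h5

lemma IsFilterRun.measurable (hrun : IsFilterRun Υ K h lawW lawV inp P W V χ out pred est)
    (h_meas : Measurable (Function.uncurry h)) (K_meas : Measurable K) (n : ℕ) :
    Measurable fun ω => (χ n ω, est n ω) := by
  obtain ⟨F, hF, hF'⟩ := hrun.exists_eq h_meas K_meas n
  rw [funext hF']
  exact hF.comp ((hrun.measurable_init.1.prodMk hrun.measurable_init.2).prodMk
    (measurable_pi_lambda _ fun i =>
      (hrun.measurable_W i).prodMk (hrun.measurable_V (i + 1))))

lemma IsFilterRun.measurable_filterError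
    (hrun : IsFilterRun Υ K h lawW lawV inp P W V χ out pred est)
    (h_meas : Measurable (Function.uncurry h)) (K_meas : Measurable K) (n : ℕ) :
    Measurable (filterError χ est n) := by
  have := hrun.measurable h_meas K_meas n
  exact this.fst.mul this.snd.inv

omit [SecondCountableTopology G] in
/-- Equivariance makes the law of the next error depend on state and estimate only through the
current error. -/
lemma measure_runStep_eq (h_meas : Measurable (Function.uncurry h)) (K_meas : Measurable K)
    (equivariant : LeftRightEquivariant h lawV) (u : G) (s : G × G) (w : G)
    {A : Set G} (hA : MeasurableSet A) :
    lawV {v | (runStep Υ K h u s (w, v)).1 * (runStep Υ K h u s (w, v)).2⁻¹ ∈ A} =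
      lawV {v | errorStep Υ K h (s.1 * s.2⁻¹) w v ∈ A} := by
  set x := Υ * w * s.1 * u with hx
  set g := Υ * s.2 * u with hg
  set η := Υ * w * (s.1 * s.2⁻¹) * Υ⁻¹ with hη
  -- The input `u` cancels between the new state `x` and the predicted estimate `g`. Equivariance at
  -- `g⁻¹` then exchanges `g • h x v` for `h η v` in law.
  have hxg : x * g⁻¹ = η := by rw [hx, hg, hη]; group
  set B : Set Y := {y | η * (K y)⁻¹ ∈ A}
  have hB : MeasurableSet B := (K_meas.inv.const_mul η) hA
  have hh : ∀ x : G, Measurable (h x) := fun x => h_meas.comp measurable_prodMk_left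
  have heq := congrArg (fun m : Measure Y => m B) (equivariant.in_law g⁻¹ x)
  simp only [hxg, inv_inv] at heq
  rw [Measure.map_apply (hh η) hB, Measure.map_apply (f := fun v => g • h x v) ((hh x).const_smul g) hB] at heq
  have h1 : {v | errorStep Υ K h (s.1 * s.2⁻¹) w v ∈ A} = h η ⁻¹' B := rfl
  rw [h1, heq]
  congr 1
  ext v
  have : (runStep Υ K h u s (w, v)).1 * (runStep Υ K h u s (w, v)).2⁻¹ =
      η * (K (g • h x v))⁻¹ := by
    rw [← hxg]
    simp only [runStep, mul_inv_rev, mul_assoc, hx, hg]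
  simp only [Set.mem_ofPred_eq, this, B, Set.mem_preimage]

/-- The current noise is independent of state and estimate, so the law of the next error is an
integral over both. By `measure_runStep_eq` the integrand depends only on their quotient. -/
lemma IsFilterRun.map_filterError_succ
    (hrun : IsFilterRun Υ K h lawW lawV inp P W V χ out pred est)
    [IsProbabilityMeasure P] [IsProbabilityMeasure lawW] [IsProbabilityMeasure lawV]
    (h_meas : Measurable (Function.uncurry h)) (K_meas : Measurable K)
    (equivariant : LeftRightEquivariant h lawV) (n : ℕ) :
    P.map (filterError χ est (n + 1)) =
      nextLaw Υ K h lawW lawV (P.map (filterError χ est n)) := by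
  have hS := hrun.measurable h_meas K_meas n
  have hZ : Measurable fun ω => (W n ω, V (n + 1) ω) :=
    (hrun.measurable_W n).prodMk (hrun.measurable_V (n + 1))
  have hlaw := (indepFun_iff_map_prod_eq_prod_map_map hS.aemeasurable hZ.aemeasurable).1
    (hrun.indepFun h_meas K_meas n)
  rw [hrun.noise_law] at hlaw
  have := Measure.isProbabilityMeasure_map (μ := P) hS.aemeasurable
  have hstep : Measurable fun q : (G × G) × G × Noise p =>
      (runStep Υ K h (inp n) q.1 q.2).1 * (runStep Υ K h (inp n) q.1 q.2).2⁻¹ :=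
    (measurable_runStep h_meas K_meas _).fst.mul (measurable_runStep h_meas K_meas _).snd.inv
  have hdiv : Measurable fun s : G × G => s.1 * s.2⁻¹ := by fun_prop
  have h1 : filterError χ est (n + 1) = (fun q : (G × G) × G × Noise p =>
      (runStep Υ K h (inp n) q.1 q.2).1 * (runStep Υ K h (inp n) q.1 q.2).2⁻¹) ∘
      fun ω => ((χ n ω, est n ω), (W n ω, V (n + 1) ω)) := by
    funext ω
    simp only [Function.comp, ← hrun.succ_eq]
    rfl
  have h2 : filterError χ est n = (fun s : G × G => s.1 * s.2⁻¹) ∘ fun ω => (χ n ω, est n ω) := rfl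
  rw [h1, ← Measure.map_map hstep (hS.prodMk hZ), hlaw, h2, ← Measure.map_map hdiv hS]
  ext A hA
  have hme := measurable_errorStep h_meas K_meas Υ
  rw [nextLaw, Measure.map_apply hstep hA, Measure.prod_apply (hstep hA),
    Measure.map_apply hme hA, Measure.prod_apply (hme hA),
    lintegral_map (measurable_measure_prodMk_left (hme hA)) hdiv]
  refine lintegral_congr fun s => ?_
  rw [Measure.prod_apply (measurable_prodMk_left (hstep hA)),
    Measure.prod_apply (measurable_prodMk_left (hme hA))]
  exact lintegral_congr fun w => measure_runStep_eq h_meas K_meas equivariant _ s w hA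

lemma IsFilterRun.map_filterError
    (hrun : IsFilterRun Υ K h lawW lawV inp P W V χ out pred est)
    [IsProbabilityMeasure P] [IsProbabilityMeasure lawW] [IsProbabilityMeasure lawV]
    (h_meas : Measurable (Function.uncurry h)) (K_meas : Measurable K)
    (equivariant : LeftRightEquivariant h lawV) (n : ℕ) :
    P.map (filterError χ est n) =
      errorLaw Υ K h lawW lawV (P.map (filterError χ est 0)) n := by
  induction n with
  | zero => rfl
  | succ n ih => rw [hrun.map_filterError_succ h_meas K_meas equivariant, ih, errorLaw]

end Filter

end InvariantFilter

/-! ### Assembly of the main theorem. -/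

open InvariantFilter in
theorem mainTheorem1 {G : Type*} [Group G] [MetricSpace G] [IsTopologicalGroup G]
    [LocallyCompactSpace G] [SecondCountableTopology G] [MeasurableSpace G] [BorelSpace G]
    (dist_right : ∀ x y g : G, dist (x * g) (y * g) = dist x y)
    {Y : Type*} [MeasurableSpace Y] [MulAction G Y] [MeasurableSMul₂ G Y] {p : ℕ}
    (h : G → InvariantFilter.Noise p → Y) (h_meas : Measurable (Function.uncurry h))
    (K : Y → G) (K_meas : Measurable K)
    (lawW : Measure G) [IsProbabilityMeasure lawW]
    (lawV : Measure (InvariantFilter.Noise p)) [IsProbabilityMeasure lawV]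
    (equivariant : InvariantFilter.LeftRightEquivariant h lawV)
    (gain_one : K (h 1 0) = 1)
    (gain_cont : Continuous fun g : G => K (h g 0))
    (Υ : G) (C : Set G) (C_nonempty : C.Nonempty) (C_compact : IsCompact C)
    (C_eq : C = closure (interior C))
    (confined : InvariantFilter.Confined Υ K h lawW lawV C)
    (α : ℝ) (α_pos : 0 < α)
    (diffusive : InvariantFilter.Diffusive lawW α)
    (reasonable : InvariantFilter.ReasonableOutput K h lawV α)
    (noiseless_conv : ∀ᵐ γ ∂((InvariantFilter.rightHaar G).restrict C),
      Tendsto (fun n : ℕ => (InvariantFilter.noiselessStep Υ K h)^[n] γ) atTop (𝓝 1)) :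
    ∃ π : ProbabilityMeasure G,
      InvariantFilter.IsStationary Υ K h lawW lawV (π : Measure G) ∧
      (∀ᵐ x ∂(π : Measure G), x ∈ C) ∧
      -- it is the only stationary distribution supported by `C`
      (∀ π' : ProbabilityMeasure G,
        InvariantFilter.IsStationary Υ K h lawW lawV (π' : Measure G) →
        (∀ᵐ x ∂(π' : Measure G), x ∈ C) → π' = π) ∧
      -- the Markov chain of the error converges to it, from every prior supported by `C`
      (∀ μ₀ : ProbabilityMeasure G, (∀ᵐ x ∂(μ₀ : Measure G), x ∈ C) →
        Tendsto (fun n : ℕ => InvariantFilter.tvDist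
          (InvariantFilter.errorLaw Υ K h lawW lawV (μ₀ : Measure G) n) (π : Measure G))
          atTop (𝓝 0)) ∧
      -- so does the law of the error of the filter, whatever the right-hand inputs
      (∀ {Ω : Type*} [MeasurableSpace Ω] (P : Measure Ω) [IsProbabilityMeasure P]
        (inp : ℕ → G) (W : ℕ → Ω → G) (V : ℕ → Ω → InvariantFilter.Noise p)
        (χ : ℕ → Ω → G) (out : ℕ → Ω → Y) (pred est : ℕ → Ω → G),
        InvariantFilter.IsFilterRun Υ K h lawW lawV inp P W V χ out pred est →
        (∀ᵐ ω ∂P, InvariantFilter.filterError χ est 0 ω ∈ C) →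
        Tendsto (fun n : ℕ => InvariantFilter.tvDist
          (P.map (InvariantFilter.filterError χ est n)) (π : Measure G))
          atTop (𝓝 0)) := by
  have hCm : MeasurableSet C := C_compact.isClosed.measurableSet
  obtain ⟨ε, hε, hdens⟩ := diffusive
  obtain ⟨δ, hδ, hout⟩ := reasonable
  have hpos := rightHaar_isOpenPosMeasure (G := G)
  set κ₁ := walkKernel lawW
  set κ₂ := correctKernel h_meas K_meas Υ lawV
  have hmem : ∀ μ : Measure G, (∀ᵐ x ∂μ, x ∈ C) ↔ μ Cᶜ = 0 := fun μ => Iff.rfl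
  have hT : Continuous (noiselessStep Υ K h) := by
    have h1 : Continuous fun x : G => Υ * x * Υ⁻¹ := by fun_prop
    exact h1.mul (gain_cont.comp h1).inv
  have hκ : ∀ x ∈ C, (κ₂ ∘ₖ κ₁) x Cᶜ = 0 := fun x hx => by
    -- One step of confinement suffices: it makes `C` absorbing for the kernel.
    have h1 := (hmem _).1 (confined x hx 1)
    rwa [errorLaw_eq_iterate h_meas K_meas, ← kernelPow_apply, kernelPow, kernelPow,
      Kernel.comp_id] at h1
  have hball : ∀ x, ENNReal.ofReal δ ≤
      κ₂ x (Metric.ball (noiselessStep Υ K h x) (α / 2)) := fun x => by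
    exact (hout (Υ * x * Υ⁻¹)).le.trans_eq (noiseKernel_apply'
      (measurable_conj_correct h_meas K_meas Υ) lawV x Metric.isOpen_ball.measurableSet).symm
  obtain ⟨N, ν, hν0, hν⟩ := exists_minorization hT α_pos (ENNReal.ofReal_pos.2 hε).ne'
    (ENNReal.ofReal_pos.2 hδ).ne' (smul_restrict_ball_le_walkKernel dist_right lawW hdens)
    hball C_compact fun x hx => exists_dist_lt_of_ae_restrict C_eq noiseless_conv hx α_pos
  obtain ⟨π, hπ1, hπ, hπC, huniq, hconv⟩ :=
    exists_stationary_tendsto hCm C_nonempty hκ N hν hν0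
  have htv : ∀ μ₀ : ProbabilityMeasure G, (∀ᵐ x ∂(μ₀ : Measure G), x ∈ C) →
      Tendsto (fun n : ℕ => tvDist (errorLaw Υ K h lawW lawV (μ₀ : Measure G) n) π)
        atTop (𝓝 0) := fun μ₀ hμ₀ => by
    obtain ⟨b, hb, hle⟩ := hconv μ₀ inferInstance ((hmem _).1 hμ₀)
    refine tendsto_of_tendsto_of_tendsto_of_le_of_le tendsto_const_nhds hb
      (fun n => bot_le) fun n => ?_
    obtain ⟨σ, r, r', h1, h2, h3⟩ := hle n
    exact (tvDist_le_of_eq_add ((errorLaw_eq_iterate h_meas K_meas _ _ _ n).trans h1) h2).trans h3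
  refine ⟨⟨π, hπ1⟩, ?_, (hmem π).2 hπC, fun π' hπ' hπC' => ?_, htv, ?_⟩
  · exact (nextLaw_eq_comp h_meas K_meas lawW lawV π).trans hπ
  · refine Subtype.ext (huniq π' inferInstance ?_ ((hmem _).1 hπC'))
    exact (nextLaw_eq_comp h_meas K_meas lawW lawV π').symm.trans hπ'
  · intro Ω _ P _ inp W V χ out pred est hrun h0
    have hm := (hrun.measurable_filterError h_meas K_meas 0).aemeasurable (μ := P)
    have := htv ⟨P.map (filterError χ est 0), Measure.isProbabilityMeasure_map hm⟩
      ((ae_map_iff hm hCm).2 h0)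
    refine this.congr fun n => ?_
    simp only [hrun.map_filterError h_meas K_meas equivariant n]
    rfl
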